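/- **Setting.** There are $r\ge 1$ robots $R=\{1,\dots,r\}$ and $r$ targets $P=\{1,\dots,r\}$. Robot $i$ can be assigned to the targets in $P^i\subseteq P$, with cost function $c^i:P^i\to\mathbb R$. Put $w(i,j)=c^i(j)$ for $j\in P^i$ and $w(i,j)=\mathfrak M$ for $j\notin P^i$, with $\mathfrak M\in\mathbb R$ a constant. An *optimal assignment* is a perfect matching $M$ of the complete bipartite graph on $R\cup P$ that minimizes $\sum_{e\in M}w(e)$. The robots communicate in synchronous rounds $t=0,1,2,\dots$; in round $t$ robot $j$ receives the state of robot $i$ if $(i,j)$ is an edge of a directed graph $\mathcal G_c(t)$, and every $\mathcal G_c(t)$ is strongly connected. For a vertex labeling $y:R\cup P\to\mathbb R$ let $\mathrm{slack}(i,j)=w(i,j)-y(i)-y(j)$. **The Distributed-Hungarian algorithm.** The state of robot $i$ consists of edge sets $E_y,E_{cand}$ (with their weights), a labeling $y$ and a counter $\gamma\in\mathbb Z$. Initially $E_y=\{(i,j^\star)\}$ with $j^\star\in\arg\min_j w(i,j)$, $E_{cand}=\emptyset$, $y(i)=w(i,j^\star)$, $y=0$ elsewhere, $\gamma=-1$.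 The robots share a deterministic routine that returns for an edge set $E$ a maximum cardinality matching $M(E)$ and a minimum vertex cover $V_c(E)=(R_c,P_c)$, and a deterministic pruning routine that replaces $E$ by a subset with the same $M$ and $V_c$. The cover is always computed from the same side: either it is, for every $E$, a minimum vertex cover with $|R_c|$ as large as possible, or it is, for every $E$, one with $|P_c|$ as large as possible. The candidate edge of robot $i$ for $(y,V_c)$ exists if $i\notin R_c$ and $P_c\ne P$, and is then an edge $(i,j^\star)$ with $j^\star\in\arg\min_{j\notin P_c}\mathrm{slack}(i,j)$, chosen by a rule of robot $i$ that depends only on its weights and on $(y,V_c)$. In each round robot $i$ acts as follows on its own state and the states received. 1. If all these counters are $-1$, it takes for $E_y$ the union of the sets $E_y$, sets $E_{cand}=\emptyset$, lets $y(k)$ be the weight of the edge of robot $k$ in $E_y$ for every robot $k$ that has one and $y=0$ elsewhere, and sets $\gamma=0$ if $|E_y|=r$ and $\gamma=-1$ otherwise. If not all are $-1$, it copies $\gamma,y,E_y$ from any one of these robots with the highest counter, and takes for $E_{cand}$ the union of the sets $E_{cand}$ of those with the highest counter. 2. If now $\gamma\ge0$ and $M(E_y)$ is not perfect, it adds its candidate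 edge for $(y,V_c(E_y))$, if there is one, to $E_{cand}$. If then $|E_{cand}|=|R\setminus R_c|$, it puts $\delta=\min_{E_{cand}}\mathrm{slack}$, subtracts $\delta$ from $y$ on $R_c$, adds $\delta$ to $y$ on $P\setminus P_c$, replaces $E_y$ by the set of edges of slack $0$ in $E_y\cup E_{cand}$, increments $\gamma$ by $1$, lets $E_{cand}$ consist of its candidate edge for the new $(y,V_c(E_y))$ (or be empty if there is none), and prunes $E_y$. A robot whose state satisfied "$\gamma\ge0$ and $M(E_y)$ is perfect" at least $r-1$ rounds ago may stop, i.e. no longer compute or send. The assignment of a robot is $M(E_y)$. **Corollary (Convergence Time).** There is an absolute constant $C$ such that for all data as above and every execution of the algorithm: * there are $T\le C r^3$ and an optimal assignment $\hat M$ such that after $T$ communication rounds, and at all later times, every robot has $\gamma\ge 0$ and assignment $\hat M$; * the counters, which start at $-1$, never exceed $C r^2$; * if at time $t$ no robot has both $\gamma\ge0$ and a perfect $M(E_y)$, then the maximal counter value of the robots increases within at most $2r-1$ rounds after $t$. -/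

import Mathlib

noncomputable section

namespace DistHungarian

section

open scoped Classical

/-! ### The centralized assignment problem

Robots and targets are both indexed by `Fin r`; an edge `(i, j)` joins robot `i` and target `j`. -/

/-- The data of a (balanced) assignment problem: robot `i` can be assigned to the targets in
`allowed i`, with cost function `cost i`; `bigM` is the weight of the edges that are added to make
the bipartite graph complete. -/
structure AssignmentProblem (r : ℕ) where
  allowed : Fin r → Finset (Fin r)
  cost : (i : Fin r) → {j : Fin r // j ∈ allowed i} → ℝ
  bigM : ℝ

/-- The edge weights of the completed graph. The row `p.weight i` is the original information of
robot `i`. -/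
def AssignmentProblem.weight {r : ℕ} (p : AssignmentProblem r) (i j : Fin r) : ℝ :=
  if h : j ∈ p.allowed i then p.cost i ⟨j, h⟩ else p.bigM

/-- A set of edges without common vertices. -/
def IsMatching {r : ℕ} (M : Finset (Fin r × Fin r)) : Prop :=
  ∀ e ∈ M, ∀ f ∈ M, (e.1 = f.1 ∨ e.2 = f.2) → e = f

def IsPerfectMatching {r : ℕ} (M : Finset (Fin r × Fin r)) : Prop :=
  IsMatching M ∧ M.card = r

/-- `M` is a matching of largest cardinality in the bipartite graph with edge set `E`. -/
def IsMaximumMatching {r : ℕ} (E M : Finset (Fin r × Fin r)) : Prop :=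
  M ⊆ E ∧ IsMatching M ∧
    ∀ M' : Finset (Fin r × Fin r), M' ⊆ E → IsMatching M' → M'.card ≤ M.card

/-- The cost of a set of edges. -/
def matchingCost {r : ℕ} (w : Fin r → Fin r → ℝ) (M : Finset (Fin r × Fin r)) : ℝ :=
  ∑ e ∈ M, w e.1 e.2

/-- `M` is a minimum weight perfect matching: an optimal assignment. -/
def IsOptimalAssignment {r : ℕ} (w : Fin r → Fin r → ℝ) (M : Finset (Fin r × Fin r)) : Prop :=
  IsPerfectMatching M ∧
    ∀ M' : Finset (Fin r × Fin r), IsPerfectMatching M' → matchingCost w M ≤ matchingCost w M'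

/-- A set of vertices, given by its robots and its targets. -/
structure VertexSet (r : ℕ) where
  robots : Finset (Fin r)
  targets : Finset (Fin r)

def VertexSet.size {r : ℕ} (V : VertexSet r) : ℕ := V.robots.card + V.targets.card

def IsVertexCover {r : ℕ} (E : Finset (Fin r × Fin r)) (V : VertexSet r) : Prop :=
  ∀ e ∈ E, e.1 ∈ V.robots ∨ e.2 ∈ V.targets

def IsMinimumVertexCover {r : ℕ} (E : Finset (Fin r × Fin r)) (V : VertexSet r) : Prop :=
  IsVertexCover E V ∧ ∀ V' : VertexSet r, IsVertexCover E V' → V.size ≤ V'.size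

/-- A minimum vertex cover with as many robots as possible. This is the cover that the
alternating-path construction of König's theorem returns, for any maximum matching, when it starts
from the unmatched robots. -/
def IsRobotSideCover {r : ℕ} (E : Finset (Fin r × Fin r)) (V : VertexSet r) : Prop :=
  IsMinimumVertexCover E V ∧
    ∀ V' : VertexSet r, IsMinimumVertexCover E V' → V'.robots.card ≤ V.robots.card

/-- A minimum vertex cover with as many targets as possible. This is the cover that the
alternating-path construction of König's theorem returns, for any maximum matching, when it starts
from the unmatched targets. -/
def IsTargetSideCover {r : ℕ} (E : Finset (Fin r × Fin r)) (V : VertexSet r) : Prop :=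
  IsMinimumVertexCover E V ∧
    ∀ V' : VertexSet r, IsMinimumVertexCover E V' → V'.targets.card ≤ V.targets.card

/-- A vertex labeling `y`. -/
structure Labeling (r : ℕ) where
  robot : Fin r → ℝ
  target : Fin r → ℝ

/-- `slack (w, y, i, j) = w (i, j) - (y (i) + y (j))`. -/
def slack {r : ℕ} (w : Fin r → Fin r → ℝ) (y : Labeling r) (i j : Fin r) : ℝ :=
  w i j - (y.robot i + y.target j)

/-! ### The local routines -/

/-- The subroutines that the pseudocode leaves to the implementation, for edge weights `w`. All the
robots run the same matching, cover and pruning routines; robot `i` has its own way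
`bestTarget i` of breaking ties between targets of minimum slack. -/
structure Routines {r : ℕ} (w : Fin r → Fin r → ℝ) where
  /-- a maximum cardinality matching, given an edge set -/
  matching : Finset (Fin r × Fin r) → Finset (Fin r × Fin r)
  matching_spec : ∀ E, IsMaximumMatching E (matching E)
  /-- a minimum vertex cover, given an edge set, always computed from the same side -/
  cover : Finset (Fin r × Fin r) → VertexSet r
  cover_spec : (∀ E, IsRobotSideCover E (cover E)) ∨ (∀ E, IsTargetSideCover E (cover E))
  /-- `Reduce_Edge_Set`: discards edges in such a way that the matching and the cover stay the same.
  (Every such pruning is permitted, in particular one to the least possible number of edges.) -/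
  reduce : Finset (Fin r × Fin r) → Finset (Fin r × Fin r)
  reduce_subset : ∀ E, reduce E ⊆ E
  reduce_matching : ∀ E, matching (reduce E) = matching E
  reduce_cover : ∀ E, cover (reduce E) = cover E
  /-- the choice of an uncovered target whose edge to robot `i` has minimum slack -/
  bestTarget : Fin r → Labeling r → VertexSet r → Fin r
  bestTarget_spec : ∀ (i : Fin r) (y : Labeling r) (V : VertexSet r),
    (∃ j, j ∉ V.targets) →
      bestTarget i y V ∉ V.targets ∧
        ∀ j, j ∉ V.targets → slack w y i (bestTarget i y V) ≤ slack w y i j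

/-- The state of a robot, which is also the message that it sends. The weights of the lean graph are
the restriction of `w` to `eqEdges ∪ candEdges`, so they are not listed separately. -/
structure RobotState (r : ℕ) where
  /-- `E_y` -/
  eqEdges : Finset (Fin r × Fin r)
  /-- `E_cand` -/
  candEdges : Finset (Fin r × Fin r)
  /-- `y` -/
  label : Labeling r
  /-- `γ` -/
  counter : ℤ

/-- The labels when all counters are `-1`: a robot with an edge in `E` gets the weight of
that edge (there is at most one such edge), all other vertices get `0`. -/
def initialLabel {r : ℕ} (w : Fin r → Fin r → ℝ) (E : Finset (Fin r × Fin r)) : Labeling r where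
  robot i := if h : ∃ j, (i, j) ∈ E then w i h.choose else 0
  target _ := 0

/-- The initial states of robot `i`: a single edge of minimum weight, and counter `-1`. -/
def IsInitialState {r : ℕ} (w : Fin r → Fin r → ℝ) (i : Fin r) (s : RobotState r) : Prop :=
  ∃ j : Fin r, (∀ k, w i j ≤ w i k) ∧
    s = { eqEdges := {(i, j)}
          candEdges := ∅
          label := initialLabel w {(i, j)}
          counter := -1 }

/-- `Build_Latest_Graph`: `tmp` is a possible output for the robots in `R'` with states `S`. -/
def IsLatestGraph {r : ℕ} (w : Fin r → Fin r → ℝ) (R' : Finset (Fin r)) (S : Fin r → RobotState r)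
    (tmp : RobotState r) : Prop :=
  ((∀ j ∈ R', (S j).counter = -1) ∧
    tmp = { eqEdges := R'.biUnion fun j => (S j).eqEdges
            candEdges := ∅
            label := initialLabel w (R'.biUnion fun j => (S j).eqEdges)
            counter := if (R'.biUnion fun j => (S j).eqEdges).card = r then 0 else -1 }) ∨
  (¬ (∀ j ∈ R', (S j).counter = -1) ∧
    ∃ l ∈ R', (∀ j ∈ R', (S j).counter ≤ (S l).counter) ∧
      tmp = { eqEdges := (S l).eqEdges
              candEdges :=
                (R'.filter fun j => (S j).counter = (S l).counter).biUnion fun j => (S j).candEdges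
              label := (S l).label
              counter := (S l).counter })

/-- `Get_Best_Edge`: the set consisting of the candidate edge of robot `i`, or `∅` if there is
none. -/
def bestEdge {r : ℕ} {w : Fin r → Fin r → ℝ} (A : Routines w) (i : Fin r) (y : Labeling r)
    (V : VertexSet r) : Finset (Fin r × Fin r) :=
  if i ∉ V.robots ∧ ∃ j, j ∉ V.targets then {(i, A.bestTarget i y V)} else ∅

/-- The smallest slack of an edge in `C` (it is only used for nonempty `C`). -/
def minSlack {r : ℕ} (w : Fin r → Fin r → ℝ) (y : Labeling r) (C : Finset (Fin r × Fin r)) : ℝ :=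
  if h : C.Nonempty then C.inf' h fun e => slack w y e.1 e.2 else 0

/-- Step 1(b) of the Hungarian method. -/
def updateLabel {r : ℕ} (y : Labeling r) (V : VertexSet r) (δ : ℝ) : Labeling r where
  robot i := if i ∈ V.robots then y.robot i - δ else y.robot i
  target j := if j ∈ V.targets then y.target j else y.target j + δ

/-- The equality subgraph edges among the edges in `E`. -/
def equalityEdges {r : ℕ} (w : Fin r → Fin r → ℝ) (y : Labeling r)
    (E : Finset (Fin r × Fin r)) : Finset (Fin r × Fin r) :=
  E.filter fun e => y.robot e.1 + y.target e.2 = w e.1 e.2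

/-- Steps 1(b) and 2 of the Hungarian method on the lean graph of `s` (whose candidate edges are
complete), followed by the choice of a new candidate edge and by pruning. -/
def advance {r : ℕ} {w : Fin r → Fin r → ℝ} (A : Routines w) (i : Fin r) (s : RobotState r) :
    RobotState r :=
  let y := updateLabel s.label (A.cover s.eqEdges) (minSlack w s.label s.candEdges)
  let E := equalityEdges w y (s.eqEdges ∪ s.candEdges)
  { eqEdges := A.reduce E
    candEdges := bestEdge A i y (A.cover E)
    label := y
    counter := s.counter + 1 }

/-- `Local_Hungarian`, executed by robot `i`. -/
def localHungarian {r : ℕ} {w : Fin r → Fin r → ℝ} (A : Routines w) (i : Fin r)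
    (tmp : RobotState r) : RobotState r :=
  let V := A.cover tmp.eqEdges
  let s : RobotState r :=
    { eqEdges := tmp.eqEdges
      candEdges := tmp.candEdges ∪ bestEdge A i tmp.label V
      label := tmp.label
      counter := tmp.counter }
  if (A.matching tmp.eqEdges).card = r then tmp
  else if (Finset.univ \ V.robots).card = s.candEdges.card then advance A i s
  else s

/-- One iteration of robot `i`: `s` is a possible new state, given the current states `S` of the
robots in `R'`, i.e. of `i` and of the robots from which it receives a message. -/
def IsIteration {r : ℕ} {w : Fin r → Fin r → ℝ} (A : Routines w) (i : Fin r) (R' : Finset (Fin r))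
    (S : Fin r → RobotState r) (s : RobotState r) : Prop :=
  ∃ tmp, IsLatestGraph w R' S tmp ∧
    s = if 0 ≤ tmp.counter then localHungarian A i tmp else tmp

/-! ### Synchronous executions -/

/-- The assignment `M^i` of a robot in state `s`. -/
def assignment {r : ℕ} {w : Fin r → Fin r → ℝ} (A : Routines w) (s : RobotState r) :
    Finset (Fin r × Fin r) :=
  A.matching s.eqEdges

/-- A robot in state `s` has found a perfect matching (matchings are only computed once the counter
is nonnegative). -/
def FoundPerfect {r : ℕ} {w : Fin r → Fin r → ℝ} (A : Routines w) (s : RobotState r) : Prop :=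
  0 ≤ s.counter ∧ IsPerfectMatching (assignment A s)

/-- There is a directed path from every robot to every other robot. -/
def StronglyConnected {r : ℕ} (G : Digraph (Fin r)) : Prop :=
  ∀ i j, Relation.ReflTransGen G.Adj i j

/-- `s t i` is the state of robot `i` after `t` communication rounds of the Distributed-Hungarian
algorithm, where `G t` is the communication graph during the round that leads from time `t`
to time `t + 1`, and `active t i` says that robot `i` takes part in that round.
A robot takes part as long as its stopping criterion does not hold; it may stop (and then neither
sends nor computes) once at least `r - 1` rounds have passed since it found a perfect
matching. Executions in which the robots never stop are included. -/
structure IsExecution {r : ℕ} {w : Fin r → Fin r → ℝ} (A : Routines w) (G : ℕ → Digraph (Fin r))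
    (active : ℕ → Fin r → Prop) (s : ℕ → Fin r → RobotState r) : Prop where
  initial : ∀ i, IsInitialState w i (s 0 i)
  halt : ∀ t i, ¬ active t i → ∃ k, k + (r - 1) ≤ t ∧ FoundPerfect A (s k i)
  step : ∀ t i, active t i →
    IsIteration A i (Finset.univ.filter fun j => j = i ∨ (active t j ∧ (G t).Adj j i)) (s t)
      (s (t + 1) i)
  stay : ∀ t i, ¬ active t i → s (t + 1) i = s t i

end

end DistHungarian

end

namespace DistHungarian

section

open scoped Classical

/-! ### Perfect matchings, vertex covers and optimality -/

/-! The robots jointly run a single centralized Hungarian method; the network affects only its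
timing. Let `F` be the set of all initial edges. A robot with counter `n ≥ 0` holds exactly the
edges and labels `stage A F n`, and its candidates form a subset of `allCandidates`, which has one
edge per uncovered robot. The test `|E_cand| = |R \ R_c|` therefore succeeds only for the complete
set, and all robots that advance make the same step (`localHungarian_cases`, `IsIteration.spec`).

Labels stay feasible and stored edges tight, so a perfect matching among them is optimal by duality.
The number of stages is bounded by comparing consecutive minimum covers: either the size grows, or
it stays and the cover loses vertices on the side that was maximized
(`IsMinimumVertexCover.progress`). As both quantities lie between `0` and `r`, there are `O(r ^ 2)`
stages (`le_of_not_isFinal`).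

For the timing, strong connectivity makes any persistent information reach everybody in `r - 1`
rounds (`flooding`). The highest counter spreads, then its candidates spread, and one more round
advances: `2 * r - 1` rounds per stage. The waiting time `r - 1` before stopping lets the first
perfect matching reach all robots. -/

lemma IsPerfectMatching.image_fst {r : ℕ} {M : Finset (Fin r × Fin r)} (h : IsPerfectMatching M) :
    M.image Prod.fst = Finset.univ := by
  rw [← Finset.card_eq_iff_eq_univ, Finset.card_image_of_injOn, h.2, Fintype.card_fin]
  exact fun e he f hf hef => h.1 e he f hf (Or.inl hef)

lemma IsPerfectMatching.image_snd {r : ℕ} {M : Finset (Fin r × Fin r)} (h : IsPerfectMatching M) :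
    M.image Prod.snd = Finset.univ := by
  rw [← Finset.card_eq_iff_eq_univ, Finset.card_image_of_injOn, h.2, Fintype.card_fin]
  exact fun e he f hf hef => h.1 e he f hf (Or.inr hef)

lemma IsPerfectMatching.sum_label {r : ℕ} {M : Finset (Fin r × Fin r)} (h : IsPerfectMatching M)
    (y : Labeling r) :
    ∑ e ∈ M, (y.robot e.1 + y.target e.2) = ∑ i, y.robot i + ∑ j, y.target j := by
  rw [Finset.sum_add_distrib, ← h.image_fst, Finset.sum_image, h.image_fst, ← h.image_snd,
    Finset.sum_image]
  · exact fun e he f hf hef => h.1 e he f hf (Or.inr hef)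
  · exact fun e he f hf hef => h.1 e he f hf (Or.inl hef)

def IsFeasible {r : ℕ} (w : Fin r → Fin r → ℝ) (y : Labeling r) : Prop :=
  ∀ i j, y.robot i + y.target j ≤ w i j

def IsTight {r : ℕ} (w : Fin r → Fin r → ℝ) (y : Labeling r) (E : Finset (Fin r × Fin r)) : Prop :=
  ∀ e ∈ E, y.robot e.1 + y.target e.2 = w e.1 e.2

/-- Weak duality: a perfect matching meets each vertex once, so the labels have the same sum over
every perfect matching. This sum bounds every cost from below and is attained on tight edges. -/
lemma IsFeasible.isOptimalAssignment {r : ℕ} {w : Fin r → Fin r → ℝ} {y : Labeling r}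
    (hy : IsFeasible w y) {M : Finset (Fin r × Fin r)} (hM : IsPerfectMatching M)
    (ht : IsTight w y M) : IsOptimalAssignment w M := by
  refine ⟨hM, fun M' hM' => ?_⟩
  calc matchingCost w M = ∑ e ∈ M, (y.robot e.1 + y.target e.2) :=
        Finset.sum_congr rfl fun e he => (ht e he).symm
    _ = ∑ e ∈ M', (y.robot e.1 + y.target e.2) := by rw [hM.sum_label, hM'.sum_label]
    _ ≤ matchingCost w M' := Finset.sum_le_sum fun e _ => hy _ _

/-- By Hall's theorem, a graph without a perfect matching has a cover with fewer than `r`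
vertices. -/
lemma exists_isVertexCover_size_lt {r : ℕ} {E : Finset (Fin r × Fin r)}
    (h : ∀ M ⊆ E, ¬ IsPerfectMatching M) : ∃ V, IsVertexCover E V ∧ V.size < r := by
  let N : Fin r → Finset (Fin r) := fun i => Finset.univ.filter fun j => (i, j) ∈ E
  have hN : ¬ ∃ f : Fin r → Fin r, Function.Injective f ∧ ∀ x, f x ∈ N x := by
    rintro ⟨f, hf, hfN⟩
    refine h (Finset.univ.image fun i => (i, f i)) ?_ ⟨?_, ?_⟩
    · intro e he
      obtain ⟨i, -, rfl⟩ := Finset.mem_image.1 he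
      exact (Finset.mem_filter.1 (hfN i)).2
    · intro e he e' he' hee
      obtain ⟨i, -, rfl⟩ := Finset.mem_image.1 he
      obtain ⟨i', -, rfl⟩ := Finset.mem_image.1 he'
      rcases hee with hee | hee
      · obtain rfl : i = i' := hee
        rfl
      · obtain rfl : i = i' := hf hee
        rfl
    · rw [Finset.card_image_of_injective _ fun i i' hi => congrArg Prod.fst hi, Finset.card_univ,
        Fintype.card_fin]
  rw [← Finset.all_card_le_biUnion_card_iff_exists_injective N] at hN
  push Not at hN
  obtain ⟨S, hS⟩ := hN
  -- For a Hall violator `S`, the robots outside `S` and the neighbours of `S` form a cover of size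
  -- `r - |S| + |N(S)| < r`.
  refine ⟨⟨Sᶜ, S.biUnion N⟩, fun e he => ?_, ?_⟩
  · by_cases h1 : e.1 ∈ S
    · exact Or.inr (Finset.mem_biUnion.2 ⟨e.1, h1, Finset.mem_filter.2 ⟨Finset.mem_univ _, he⟩⟩)
    · exact Or.inl (Finset.mem_compl.2 h1)
  · have h1 := Finset.card_compl_add_card S
    rw [Fintype.card_fin] at h1
    simp only [VertexSet.size]
    omega

def VertexSet.robotJoin {r : ℕ} (V V' : VertexSet r) : VertexSet r :=
  ⟨V.robots ∪ V'.robots, V.targets ∩ V'.targets⟩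

/-- Size is modular: if both mixtures of `V` and `V'` cover `E` and `V` is minimum, then `V'` is at
least as large as `V`, and equality makes both mixtures minimum. -/
lemma VertexSet.size_robotJoin_add {r : ℕ} (V V' : VertexSet r) :
    (V.robotJoin V').size + (⟨V.robots ∩ V'.robots, V.targets ∪ V'.targets⟩ : VertexSet r).size =
      V.size + V'.size := by
  have h1 := Finset.card_union_add_card_inter V.robots V'.robots
  have h2 := Finset.card_union_add_card_inter V.targets V'.targets
  simp only [VertexSet.size, VertexSet.robotJoin]
  omega

/-- The comparison of covers on which the progress of the Hungarian method rests: `E'` contains the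
edges of `E` that `V` covers only once, and an edge that `V` does not cover. -/
lemma IsMinimumVertexCover.progress {r : ℕ} {E E' : Finset (Fin r × Fin r)} {V V' : VertexSet r}
    (hV : IsMinimumVertexCover E V) (hV' : IsVertexCover E' V')
    (hE : ∀ e ∈ E, ¬ (e.1 ∈ V.robots ∧ e.2 ∈ V.targets) → e ∈ E')
    (hnew : ∃ e ∈ E', e.1 ∉ V.robots ∧ e.2 ∉ V.targets) :
    V.size < V'.size ∨ V.size = V'.size ∧
      (IsRobotSideCover E V → V'.robots.card < V.robots.card) ∧
      (IsTargetSideCover E V → V'.targets.card < V.targets.card) := by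
  have hJ : IsVertexCover E (V.robotJoin V') := by
    intro e he
    have h1 := hV.1 e he
    have h2 := fun h => hV' e (hE e he h)
    simp only [VertexSet.robotJoin, Finset.mem_union, Finset.mem_inter]
    tauto
  have hI : IsVertexCover E ⟨V.robots ∩ V'.robots, V.targets ∪ V'.targets⟩ := by
    intro e he
    have h1 := hV.1 e he
    have h2 := fun h => hV' e (hE e he h)
    simp only [Finset.mem_union, Finset.mem_inter]
    tauto
  have hs := V.size_robotJoin_add V'
  have hJs := hV.2 _ hJ
  have hIs := hV.2 _ hI
  rcases lt_or_ge V.size V'.size with h | h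
  · exact Or.inl h
  -- The new edge is covered by `V'` but not by `V`; this makes the inequalities below strict.
  have hne : ¬ (V'.robots = V.robots ∧ V'.targets = V.targets) := by
    rintro ⟨h1, h2⟩
    obtain ⟨e, he, he1, he2⟩ := hnew
    have h3 := hV' e he
    rw [h1, h2] at h3
    tauto
  refine Or.inr ⟨by omega, fun hR => ?_, fun hT => ?_⟩
  -- The join is again a minimum cover, so maximality of `V.robots` forces `V'.robots ⊆ V.robots`.
  · have hle := hR.2 _ ⟨hJ, fun W hW => by have := hV.2 W hW; omega⟩
    have hu : V.robots ∪ V'.robots = V.robots :=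
      (Finset.eq_of_subset_of_card_le Finset.subset_union_left hle).symm
    have hsub : V'.robots ⊆ V.robots := hu ▸ Finset.subset_union_right
    refine lt_of_le_of_ne (Finset.card_le_card hsub) fun hc => hne ?_
    have h1 := Finset.eq_of_subset_of_card_le hsub hc.ge
    refine ⟨h1, ?_⟩
    simp only [VertexSet.size, VertexSet.robotJoin, hu] at *
    have h2 : V.targets ∩ V'.targets = V.targets :=
      Finset.eq_of_subset_of_card_le Finset.inter_subset_left (by omega)
    exact (Finset.eq_of_subset_of_card_le (Finset.inter_eq_left.1 h2) (by omega)).symm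
  · have hle := hT.2 _ ⟨hI, fun W hW => by have := hV.2 W hW; omega⟩
    have hu : V.targets ∪ V'.targets = V.targets :=
      (Finset.eq_of_subset_of_card_le Finset.subset_union_left hle).symm
    have hsub : V'.targets ⊆ V.targets := hu ▸ Finset.subset_union_right
    refine lt_of_le_of_ne (Finset.card_le_card hsub) fun hc => hne ?_
    have h1 := Finset.eq_of_subset_of_card_le hsub hc.ge
    refine ⟨?_, h1⟩
    simp only [VertexSet.size, VertexSet.robotJoin, hu] at *
    have h2 : V.robots ∩ V'.robots = V.robots :=
      Finset.eq_of_subset_of_card_le Finset.inter_subset_left (by omega)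
    exact (Finset.eq_of_subset_of_card_le (Finset.inter_eq_left.1 h2) (by omega)).symm

lemma IsMinimumVertexCover.size_le {r : ℕ} {E : Finset (Fin r × Fin r)} {V : VertexSet r}
    (h : IsMinimumVertexCover E V) : V.size ≤ r := by
  have := h.2 ⟨Finset.univ, ∅⟩ fun e _ => Or.inl (Finset.mem_univ _)
  simpa [VertexSet.size] using this

/-! ### The common sequence of equality subgraphs and labelings -/

variable {r : ℕ} {w : Fin r → Fin r → ℝ}

lemma Routines.isMinimumVertexCover (A : Routines w) (E : Finset (Fin r × Fin r)) :
    IsMinimumVertexCover E (A.cover E) :=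
  A.cover_spec.elim (fun h => (h E).1) fun h => (h E).1

/-- Hides from which side the covers are computed: `f` counts the vertices on the maximized side. -/
lemma Routines.exists_measure (A : Routines w) :
    ∃ f : VertexSet r → ℕ, (∀ V, f V ≤ r) ∧ ∀ E E',
      (∀ e ∈ E, ¬ (e.1 ∈ (A.cover E).robots ∧ e.2 ∈ (A.cover E).targets) → e ∈ E') →
      (∃ e ∈ E', e.1 ∉ (A.cover E).robots ∧ e.2 ∉ (A.cover E).targets) →
      (A.cover E).size < (A.cover E').size ∨
        (A.cover E).size = (A.cover E').size ∧ f (A.cover E') < f (A.cover E) := by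
  rcases A.cover_spec with h | h
  · refine ⟨fun V => V.robots.card, fun V => card_finset_fin_le _, fun E E' h1 h2 => ?_⟩
    exact ((A.isMinimumVertexCover E).progress (A.isMinimumVertexCover E').1 h1 h2).imp_right
      fun h3 => ⟨h3.1, h3.2.1 (h E)⟩
  · refine ⟨fun V => V.targets.card, fun V => card_finset_fin_le _, fun E E' h1 h2 => ?_⟩
    exact ((A.isMinimumVertexCover E).progress (A.isMinimumVertexCover E').1 h1 h2).imp_right
      fun h3 => ⟨h3.1, h3.2.2 (h E)⟩

/-- All the candidate edges for the labeling `y` and the edge set `E`. -/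
def allCandidates (A : Routines w) (E : Finset (Fin r × Fin r)) (y : Labeling r) :
    Finset (Fin r × Fin r) :=
  Finset.univ.biUnion fun i => bestEdge A i y (A.cover E)

def nextLabel (A : Routines w) (E : Finset (Fin r × Fin r)) (y : Labeling r) : Labeling r :=
  updateLabel y (A.cover E) (minSlack w y (allCandidates A E y))

noncomputable def nextEdges (A : Routines w) (E : Finset (Fin r × Fin r)) (y : Labeling r) :
    Finset (Fin r × Fin r) :=
  equalityEdges w (nextLabel A E y) (E ∪ allCandidates A E y)

/-- The equality edges and the labeling that belong to the counter value `n`, if the edges with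
which the robots start are those in `F`. -/
noncomputable def stage (A : Routines w) (F : Finset (Fin r × Fin r)) :
    ℕ → Finset (Fin r × Fin r) × Labeling r
  | 0 => (F, initialLabel w F)
  | n + 1 => (A.reduce (nextEdges A (stage A F n).1 (stage A F n).2),
      nextLabel A (stage A F n).1 (stage A F n).2)

/-- A minimum cover with fewer than `r` vertices misses a robot and a target. Hence candidates
exist, and `minSlack` is a true minimum, not its default `0`. -/
lemma Routines.exists_notMem_targets (A : Routines w) {E : Finset (Fin r × Fin r)}
    (h : (A.matching E).card ≠ r) :
    (∃ i, i ∉ (A.cover E).robots) ∧ ∃ j, j ∉ (A.cover E).targets := by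
  have hM := A.matching_spec E
  obtain ⟨V, hV, hVr⟩ := exists_isVertexCover_size_lt (E := E) fun M hME hM' => by
    have h1 := hM.2.2 M hME hM'.1
    have h2 := Finset.card_image_of_injOn (s := A.matching E) (f := Prod.fst)
      fun e he f hf hef => hM.2.1 e he f hf (Or.inl hef)
    have h3 := card_finset_fin_le ((A.matching E).image Prod.fst)
    have h4 := hM'.2
    omega
  have hs := (A.isMinimumVertexCover E).2 V hV
  have key : ∀ S : Finset (Fin r), S.card < r → ∃ j, j ∉ S := by
    intro S hS
    by_contra! hall
    rw [Finset.eq_univ_iff_forall.2 hall, Finset.card_univ, Fintype.card_fin] at hS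
    exact lt_irrefl _ hS
  simp only [VertexSet.size] at hs hVr
  exact ⟨key _ (by omega), key _ (by omega)⟩

lemma mem_allCandidates {A : Routines w} {E : Finset (Fin r × Fin r)} {y : Labeling r}
    {e : Fin r × Fin r} :
    e ∈ allCandidates A E y ↔ e.1 ∉ (A.cover E).robots ∧ (∃ j, j ∉ (A.cover E).targets) ∧
      e.2 = A.bestTarget e.1 y (A.cover E) := by
  simp only [allCandidates, Finset.mem_biUnion, Finset.mem_univ, true_and, bestEdge]
  constructor
  · rintro ⟨i, hi⟩
    split_ifs at hi with h
    · rw [Finset.mem_singleton] at hi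
      subst hi
      exact ⟨h.1, h.2, rfl⟩
    · simp at hi
  · rintro ⟨h1, h2, h3⟩
    refine ⟨e.1, ?_⟩
    rw [if_pos ⟨h1, h2⟩, Finset.mem_singleton, ← h3]

lemma bestEdge_subset (A : Routines w) (E : Finset (Fin r × Fin r)) (y : Labeling r) (i : Fin r) :
    bestEdge A i y (A.cover E) ⊆ allCandidates A E y :=
  Finset.subset_biUnion_of_mem (fun i => bestEdge A i y (A.cover E)) (Finset.mem_univ i)

/-- This count lets a robot recognize a complete candidate set by its cardinality alone. -/
lemma card_allCandidates (A : Routines w) {E : Finset (Fin r × Fin r)} (y : Labeling r)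
    (h : (A.matching E).card ≠ r) :
    (allCandidates A E y).card = (Finset.univ \ (A.cover E).robots).card := by
  have h1 : allCandidates A E y =
      (Finset.univ \ (A.cover E).robots).image fun i => (i, A.bestTarget i y (A.cover E)) := by
    ext e
    simp only [mem_allCandidates, Finset.mem_image, Finset.mem_sdiff, Finset.mem_univ, true_and]
    constructor
    · rintro ⟨h1, -, h3⟩
      exact ⟨e.1, h1, by rw [← h3]⟩
    · rintro ⟨i, hi, rfl⟩
      exact ⟨hi, (A.exists_notMem_targets h).2, rfl⟩
  rw [h1, Finset.card_image_of_injective _ fun i i' hi => congrArg Prod.fst hi]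

lemma minSlack_mem {y : Labeling r} {C : Finset (Fin r × Fin r)} (h : C.Nonempty) :
    ∃ e ∈ C, minSlack w y C = slack w y e.1 e.2 := by
  rw [minSlack, dif_pos h]
  exact Finset.exists_mem_eq_inf' h _

lemma minSlack_le {y : Labeling r} {C : Finset (Fin r × Fin r)} {e : Fin r × Fin r} (h : e ∈ C) :
    minSlack w y C ≤ slack w y e.1 e.2 := by
  rw [minSlack, dif_pos ⟨e, h⟩]
  exact Finset.inf'_le (fun e : Fin r × Fin r => slack w y e.1 e.2) h

/-- A label sum rises, by `δ`, only on pairs uncovered at both ends. One candidate per robot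
suffices: it has least slack among the uncovered targets of that robot, so `δ` is at most the slack
of every such pair. -/
lemma IsFeasible.nextLabel {A : Routines w} {E : Finset (Fin r × Fin r)} {y : Labeling r}
    (hy : IsFeasible w y) (h : (A.matching E).card ≠ r) : IsFeasible w (nextLabel A E y) := by
  obtain ⟨⟨i0, hi0⟩, hj⟩ := A.exists_notMem_targets h
  have hne : (allCandidates A E y).Nonempty :=
    ⟨(i0, A.bestTarget i0 y (A.cover E)), mem_allCandidates.2 ⟨hi0, hj, rfl⟩⟩
  intro i j
  have h0 : 0 ≤ minSlack w y (allCandidates A E y) := by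
    obtain ⟨e, -, he⟩ := minSlack_mem (w := w) (y := y) hne
    rw [he, slack]
    linarith [hy e.1 e.2]
  have hij := hy i j
  simp only [DistHungarian.nextLabel, updateLabel]
  split_ifs with h1 h2 h2
  · linarith
  · linarith
  · linarith
  · have h3 := minSlack_le (w := w) (y := y) (C := allCandidates A E y)
      (e := (i, A.bestTarget i y (A.cover E))) (mem_allCandidates.2 ⟨h1, hj, rfl⟩)
    have h4 := (A.bestTarget_spec i y (A.cover E) hj).2 j h2
    simp only [slack] at h3 h4
    linarith

/-- On an edge covered exactly once the changes cancel or vanish; only doubly covered edges can lose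
tightness. -/
lemma mem_nextEdges_of_mem {A : Routines w} {E : Finset (Fin r × Fin r)} {y : Labeling r}
    (ht : IsTight w y E) (e : Fin r × Fin r) (he : e ∈ E)
    (h : ¬ (e.1 ∈ (A.cover E).robots ∧ e.2 ∈ (A.cover E).targets)) : e ∈ nextEdges A E y := by
  refine Finset.mem_filter.2 ⟨Finset.mem_union_left _ he, ?_⟩
  have h1 := (A.isMinimumVertexCover E).1 e he
  have h2 := ht e he
  simp only [nextLabel, updateLabel]
  split_ifs with h3 h4 h4
  · exact absurd ⟨h3, h4⟩ h
  · linarith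
  · linarith
  · tauto

/-- The candidate that attains `δ` becomes tight. -/
lemma exists_uncovered_mem_nextEdges {A : Routines w} {E : Finset (Fin r × Fin r)} {y : Labeling r}
    (h : (A.matching E).card ≠ r) :
    ∃ e ∈ nextEdges A E y, e.1 ∉ (A.cover E).robots ∧ e.2 ∉ (A.cover E).targets := by
  obtain ⟨⟨i0, hi0⟩, hj⟩ := A.exists_notMem_targets h
  have hne : (allCandidates A E y).Nonempty :=
    ⟨(i0, A.bestTarget i0 y (A.cover E)), mem_allCandidates.2 ⟨hi0, hj, rfl⟩⟩
  obtain ⟨e, he, hδ⟩ := minSlack_mem (w := w) (y := y) hne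
  obtain ⟨h1, -, h2⟩ := mem_allCandidates.1 he
  have h3 : e.2 ∉ (A.cover E).targets := h2 ▸ (A.bestTarget_spec e.1 y (A.cover E) hj).1
  refine ⟨e, Finset.mem_filter.2 ⟨Finset.mem_union_right _ he, ?_⟩, h1, h3⟩
  simp only [nextLabel, updateLabel, if_neg h1, if_neg h3, hδ, slack]
  ring

/-- The counter value `n` is final if the matching that belongs to it is perfect. -/
def IsFinal (A : Routines w) (F : Finset (Fin r × Fin r)) (n : ℕ) : Prop :=
  (A.matching (stage A F n).1).card = r

lemma stage_feasible (A : Routines w) {F : Finset (Fin r × Fin r)}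
    (hF : IsFeasible w (initialLabel w F)) (htF : IsTight w (initialLabel w F) F) :
    ∀ n, (∀ m < n, ¬ IsFinal A F m) →
      IsFeasible w (stage A F n).2 ∧ IsTight w (stage A F n).2 (stage A F n).1
  | 0, _ => ⟨hF, htF⟩
  | n + 1, h => by
    have ih := stage_feasible A hF htF n fun m hm => h m (by omega)
    exact ⟨ih.1.nextLabel (h n n.lt_succ_self),
      fun e he => (Finset.mem_filter.1 (A.reduce_subset _ he)).2⟩

lemma le_of_not_isFinal (A : Routines w) {F : Finset (Fin r × Fin r)}
    (hF : IsFeasible w (initialLabel w F)) (htF : IsTight w (initialLabel w F) F) (hr : 0 < r)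
    {n : ℕ} (hn : ∀ m < n, ¬ IsFinal A F m) : n ≤ 3 * r ^ 2 := by
  obtain ⟨f, hf, hprog⟩ := A.exists_measure
  -- A step that enlarges the cover gains `r + 1`, which pays for the counter and for a rise of `f`
  -- by at most `r`; any other step is paid for by the drop of `f`. With size at most `r` this gives
  -- `n ≤ r * (r + 1) + r ≤ 3 * r ^ 2`.
  have key : ∀ n, (∀ m < n, ¬ IsFinal A F m) →
      n + f (A.cover (stage A F n).1) ≤ (A.cover (stage A F n).1).size * (r + 1) + r := by
    intro n
    induction n with
    | zero => intro _; have := hf (A.cover (stage A F 0).1); omega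
    | succ n ih =>
      intro h
      have hn' : ∀ m < n, ¬ IsFinal A F m := fun m hm => h m (by omega)
      have ih := ih hn'
      have hp := hprog (stage A F n).1 (nextEdges A (stage A F n).1 (stage A F n).2)
        (mem_nextEdges_of_mem (stage_feasible A hF htF n hn').2)
        (exists_uncovered_mem_nextEdges (h n n.lt_succ_self))
      have hc : A.cover (stage A F (n + 1)).1 =
          A.cover (nextEdges A (stage A F n).1 (stage A F n).2) := A.reduce_cover _
      rw [hc]
      have hf' := hf (A.cover (nextEdges A (stage A F n).1 (stage A F n).2))
      rcases hp with hp | ⟨hp, hp'⟩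
      · have := Nat.mul_le_mul_right (r + 1) (Nat.succ_le_of_lt hp)
        rw [Nat.succ_mul] at this
        omega
      · rw [← hp]
        omega
  have h1 := key n hn
  have h2 := Nat.mul_le_mul_right (r + 1) (A.isMinimumVertexCover (stage A F n).1).size_le
  nlinarith

/-! ### The states of the robots -/

/-- The states that can occur at robot `i`: its counter determines the labeling and the equality
edges. -/
def IsConsistent (A : Routines w) (F : Finset (Fin r × Fin r)) (i : Fin r) (s : RobotState r) :
    Prop :=
  (s.counter = -1 ∧ s.eqEdges ⊆ F ∧ ∀ e ∈ F, e.1 = i → e ∈ s.eqEdges) ∨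
  ∃ n : ℕ, s.counter = n ∧ s.eqEdges = (stage A F n).1 ∧ s.label = (stage A F n).2 ∧
    s.candEdges ⊆ allCandidates A (stage A F n).1 (stage A F n).2 ∧
    (∀ m < n, ¬ IsFinal A F m) ∧
    (¬ IsFinal A F n →
      bestEdge A i (stage A F n).2 (A.cover (stage A F n).1) ⊆ s.candEdges)

lemma IsConsistent.of_counter {A : Routines w} {F : Finset (Fin r × Fin r)} {i : Fin r}
    {s : RobotState r} (h : IsConsistent A F i s) {n : ℕ} (hn : s.counter = n) :
    s.eqEdges = (stage A F n).1 ∧ s.label = (stage A F n).2 ∧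
    s.candEdges ⊆ allCandidates A (stage A F n).1 (stage A F n).2 ∧
    (∀ m < n, ¬ IsFinal A F m) ∧
    (¬ IsFinal A F n →
      bestEdge A i (stage A F n).2 (A.cover (stage A F n).1) ⊆ s.candEdges) := by
  rcases h with h | ⟨m, hm, h⟩
  · have := h.1
    omega
  · obtain rfl : n = m := by omega
    exact h

lemma IsConsistent.neg_one_le {A : Routines w} {F : Finset (Fin r × Fin r)} {i : Fin r}
    {s : RobotState r} (h : IsConsistent A F i s) : -1 ≤ s.counter := by
  rcases h with h | ⟨m, hm, h⟩ <;> omega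

lemma IsConsistent.foundPerfect_iff {A : Routines w} {F : Finset (Fin r × Fin r)} {i : Fin r}
    {s : RobotState r} (h : IsConsistent A F i s) :
    FoundPerfect A s ↔ ∃ n : ℕ, s.counter = n ∧ IsFinal A F n := by
  constructor
  · rintro ⟨h0, h1⟩
    obtain ⟨n, hn⟩ := Int.eq_ofNat_of_zero_le h0
    refine ⟨n, hn, ?_⟩
    rw [IsFinal, ← (h.of_counter hn).1]
    exact h1.2
  · rintro ⟨n, hn, hf⟩
    refine ⟨by omega, (A.matching_spec _).2.1, ?_⟩
    rw [assignment, (h.of_counter hn).1]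
    exact hf

/-- The last alternative records that the incoming candidates were incomplete, since otherwise the
cardinality test would succeed. This is what flooding later contradicts. -/
lemma localHungarian_cases {A : Routines w} {F : Finset (Fin r × Fin r)} (i : Fin r)
    {tmp : RobotState r} {n : ℕ} (hn : tmp.counter = n) (hE : tmp.eqEdges = (stage A F n).1)
    (hy : tmp.label = (stage A F n).2)
    (hC : tmp.candEdges ⊆ allCandidates A (stage A F n).1 (stage A F n).2)
    (hm : ∀ m < n, ¬ IsFinal A F m) :
    IsConsistent A F i (localHungarian A i tmp) ∧
    ((IsFinal A F n ∧ localHungarian A i tmp = tmp) ∨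
     (¬ IsFinal A F n ∧ (localHungarian A i tmp).counter = n + 1) ∨
     (¬ IsFinal A F n ∧ (localHungarian A i tmp).counter = n ∧
      tmp.candEdges ⊆ (localHungarian A i tmp).candEdges ∧
      tmp.candEdges ≠ allCandidates A (stage A F n).1 (stage A F n).2)) := by
  have hfin : (A.matching tmp.eqEdges).card = r ↔ IsFinal A F n := by rw [IsFinal, hE]
  by_cases hp : IsFinal A F n
  · have heq : localHungarian A i tmp = tmp := by
      rw [localHungarian, if_pos (hfin.2 hp)]
    rw [heq]
    exact ⟨Or.inr ⟨n, hn, hE, hy, hC, hm, fun h => absurd hp h⟩, Or.inl ⟨hp, rfl⟩⟩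
  have hsub := Finset.union_subset hC (bestEdge_subset A (stage A F n).1 (stage A F n).2 i)
  have hcard := card_allCandidates A (stage A F n).2 hp
  rw [localHungarian]
  simp only
  rw [if_neg (hfin.not.2 hp), hE, hy]
  split_ifs with h
  · have hfull := Finset.eq_of_subset_of_card_le hsub (by rw [hcard, h])
    refine ⟨Or.inr ⟨n + 1, ?_⟩, Or.inr (Or.inl ⟨hp, by simp [advance, hn]⟩)⟩
    simp only [advance, hfull, hn]
    refine ⟨by simp, rfl, rfl, ?_, ?_, fun _ => ?_⟩
    -- `advance` selects the new candidate before pruning, while `stage` stores the pruned edges;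
    -- `A.reduce_cover` identifies the two covers.
    · have := bestEdge_subset A (stage A F (n + 1)).1 (stage A F (n + 1)).2 i
      rwa [show A.cover (stage A F (n + 1)).1 = _ from A.reduce_cover _] at this
    · intro m hmn
      rcases Nat.lt_succ_iff_lt_or_eq.1 hmn with h1 | rfl
      exacts [hm m h1, hp]
    · rw [show A.cover (stage A F (n + 1)).1 = _ from A.reduce_cover _]
      rfl
  · refine ⟨Or.inr ⟨n, hn, rfl, rfl, hsub, hm, fun _ => Finset.subset_union_right⟩,
      Or.inr (Or.inr ⟨hp, hn, Finset.subset_union_left, fun hfull => h ?_⟩)⟩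
    have : tmp.candEdges ∪ bestEdge A i (stage A F n).2 (A.cover (stage A F n).1) =
        tmp.candEdges :=
      Finset.union_eq_left.2 (hfull ▸ bestEdge_subset A _ _ i)
    rw [this, hfull, hcard]

/-- What one iteration of robot `i` achieves. -/
lemma IsIteration.spec {A : Routines w} {F : Finset (Fin r × Fin r)}
    (hFr : F.card = r) {i : Fin r} {R' : Finset (Fin r)} (hi : i ∈ R')
    {S : Fin r → RobotState r} (hS : ∀ j, IsConsistent A F j (S j)) {s : RobotState r}
    (h : IsIteration A i R' S s) :
    IsConsistent A F i s ∧ (∀ j ∈ R', (S j).counter ≤ s.counter) ∧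
    (s.counter = -1 → s.eqEdges ≠ F ∧ ∀ j ∈ R', (S j).eqEdges ⊆ s.eqEdges) ∧
    ∀ n : ℕ, s.counter = n → ¬ IsFinal A F n → ∀ j ∈ R', (S j).counter = n →
      (S j).candEdges ⊆ s.candEdges ∧
      (S j).candEdges ≠ allCandidates A (stage A F n).1 (stage A F n).2 := by
  obtain ⟨tmp, htmp, rfl⟩ := h
  rcases htmp with ⟨hall, htmp⟩ | ⟨hnall, l, hl, hmax, htmp⟩
  · have hsub : (R'.biUnion fun j => (S j).eqEdges) ⊆ F := by
      intro e he
      obtain ⟨j, hj, he⟩ := Finset.mem_biUnion.1 he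
      rcases hS j with h1 | ⟨n, hn, -⟩
      · exact h1.2.1 he
      · have := hall j hj
        omega
    by_cases hc : (R'.biUnion fun j => (S j).eqEdges).card = r
    -- As `F` has `r` edges, collecting `r` of them means having all, so every robot enters stage
    -- `0` with the same data.
    · have hEF := Finset.eq_of_subset_of_card_le hsub (by omega)
      rw [if_pos hc, hEF] at htmp
      have hspec := localHungarian_cases (A := A) (F := F) i (tmp := tmp) (n := 0)
        (by rw [htmp]; rfl) (by rw [htmp]; rfl) (by rw [htmp]; rfl) (by rw [htmp]; simp) (by simp)
      have h0 : tmp.counter = 0 := by rw [htmp]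
      rw [if_pos h0.ge]
      have h1 : 0 ≤ (localHungarian A i tmp).counter := by
        rcases hspec.2 with ⟨-, h⟩ | ⟨-, h⟩ | ⟨-, h, -⟩ <;> rw [h] <;> simp [h0]
      refine ⟨hspec.1, fun j hj => by have := hall j hj; omega, fun h => by omega,
        fun n hn hnf j hj hjn => by have := hall j hj; omega⟩
    · rw [if_neg hc] at htmp
      rw [if_neg (by rw [htmp]; simp)]
      subst htmp
      refine ⟨Or.inl ⟨rfl, hsub, fun e he hei => Finset.mem_biUnion.2 ⟨i, hi, ?_⟩⟩,
        fun j hj => (hall j hj).le, fun _ => ⟨fun h => hc ((congrArg Finset.card h).trans hFr), fun j hj =>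
          Finset.subset_biUnion_of_mem (fun j => (S j).eqEdges) hj⟩,
        fun n hn hnf j hj hjn => by have := hall j hj; omega⟩
      rcases hS i with h1 | ⟨n, hn, -⟩
      · exact h1.2.2 e he hei
      · have := hall i hi
        omega
  · push Not at hnall
    obtain ⟨j0, hj0, hj0'⟩ := hnall
    have h0 : 0 ≤ (S l).counter := by
      have := (hS j0).neg_one_le
      have := hmax j0 hj0
      omega
    obtain ⟨n, hn⟩ := Int.eq_ofNat_of_zero_le h0
    obtain ⟨hE, hy, -, hm, -⟩ := (hS l).of_counter hn
    -- Robots with the highest counter all sit at stage `n`, so their candidates may be merged.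
    have hC : tmp.candEdges ⊆ allCandidates A (stage A F n).1 (stage A F n).2 := by
      rw [htmp]
      refine Finset.biUnion_subset.2 fun j hj => ?_
      have := (Finset.mem_filter.1 hj).2
      exact ((hS j).of_counter (this.trans hn)).2.2.1
    have hCj : ∀ j ∈ R', (S j).counter = n → (S j).candEdges ⊆ tmp.candEdges := by
      intro j hj hjn
      rw [htmp]
      exact Finset.subset_biUnion_of_mem (fun j => (S j).candEdges)
        (Finset.mem_filter.2 ⟨hj, hjn.trans hn.symm⟩)
    have htn : tmp.counter = n := by rw [htmp]; exact hn
    have hspec := localHungarian_cases (A := A) (F := F) i (tmp := tmp) htn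
      (by rw [htmp]; exact hE) (by rw [htmp]; exact hy) hC hm
    rw [if_pos (by omega)]
    have h1 : (n : ℤ) ≤ (localHungarian A i tmp).counter := by
      rcases hspec.2 with ⟨-, h⟩ | ⟨-, h⟩ | ⟨-, h, -⟩ <;> rw [h] <;> omega
    refine ⟨hspec.1, fun j hj => by have := hmax j hj; omega, fun h => by omega,
      fun k hk hkf j hj hjk => ?_⟩
    have hkn : k = n := by have := hmax j hj; omega
    subst hkn
    rcases hspec.2 with ⟨hf, -⟩ | ⟨-, h⟩ | ⟨-, -, h2, h3⟩
    · exact absurd hf hkf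
    · omega
    · exact ⟨(hCj j hj hjk).trans h2, fun h => h3 (hC.antisymm (h ▸ hCj j hj hjk))⟩

/-! ### Executions -/

/-- In a sequence of strongly connected graphs, what some robot knows is known to all the robots
after `r - 1` rounds. -/
lemma flooding {G : ℕ → Digraph (Fin r)} (hG : ∀ t, StronglyConnected (G t))
    (P : ℕ → Fin r → Prop) (t₀ : ℕ) (h₀ : ∃ i, P t₀ i)
    (hstay : ∀ t, t₀ ≤ t → t < t₀ + (r - 1) → ∀ i, P t i → P (t + 1) i)
    (hstep : ∀ t, t₀ ≤ t → t < t₀ + (r - 1) → ∀ i j, P t i → (G t).Adj i j → P (t + 1) j) :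
    ∀ i, P (t₀ + (r - 1)) i := by
  -- Each round informs at least one new robot until all are informed: by strong connectivity an
  -- edge leaves every nonempty proper set of informed robots.
  have key : ∀ k ≤ r - 1, k + 1 ≤ (Finset.univ.filter (P (t₀ + k))).card := by
    intro k
    induction k with
    | zero =>
      intro _
      obtain ⟨i, hi⟩ := h₀
      exact Finset.card_pos.2 ⟨i, Finset.mem_filter.2 ⟨Finset.mem_univ _, hi⟩⟩
    | succ k ih =>
      intro hk
      have ih := ih (by omega)
      have hsub : Finset.univ.filter (P (t₀ + k)) ⊆ Finset.univ.filter (P (t₀ + (k + 1))) :=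
        Finset.monotone_filter_right _ fun i _ hi =>
          hstay (t₀ + k) (by omega) (by omega) i hi
      by_cases hall : ∀ i, P (t₀ + k) i
      · have h1 := Finset.card_le_card hsub
        rw [Finset.filter_true_of_mem fun i _ => hall i, Finset.card_univ, Fintype.card_fin] at h1
        omega
      push Not at hall
      obtain ⟨b, hb⟩ := hall
      obtain ⟨a, ha⟩ := Finset.card_pos.1 (by omega : 0 < (Finset.univ.filter (P (t₀ + k))).card)
      have ha := (Finset.mem_filter.1 ha).2
      have hedge : ∃ i j, P (t₀ + k) i ∧ ¬ P (t₀ + k) j ∧ (G (t₀ + k)).Adj i j := by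
        by_contra! hno
        have hreach : ∀ c, Relation.ReflTransGen (G (t₀ + k)).Adj a c → P (t₀ + k) c := by
          intro c hc
          induction hc with
          | refl => exact ha
          | tail _ hcd ih =>
            by_contra hd
            exact hno _ _ ih hd hcd
        exact hb (hreach b (hG _ a b))
      obtain ⟨i, j, hi, hj, hij⟩ := hedge
      have hlt : Finset.univ.filter (P (t₀ + k)) ⊂ Finset.univ.filter (P (t₀ + (k + 1))) := by
        refine (Finset.ssubset_iff_of_subset hsub).2 ⟨j, ?_, ?_⟩
        · exact Finset.mem_filter.2 ⟨Finset.mem_univ _,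
            hstep (t₀ + k) (by omega) (by omega) i j hi hij⟩
        · exact fun h => hj (Finset.mem_filter.1 h).2
      have := Finset.card_lt_card hlt
      omega
  intro i
  have h1 := key (r - 1) le_rfl
  have h2 : Finset.univ.filter (P (t₀ + (r - 1))) = Finset.univ := by
    refine Finset.eq_univ_of_card _ (le_antisymm (Finset.card_le_univ _) ?_)
    rw [Fintype.card_fin]
    omega
  exact (Finset.mem_filter.1 (h2 ▸ Finset.mem_univ i)).2

/-- The edges with which the robots start. -/
lemma exists_initial_edges (A : Routines w) {s : Fin r → RobotState r}
    (h : ∀ i, IsInitialState w i (s i)) :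
    ∃ F : Finset (Fin r × Fin r), F.card = r ∧ IsFeasible w (initialLabel w F) ∧
      IsTight w (initialLabel w F) F ∧ ∀ i, IsConsistent A F i (s i) := by
  choose j hj hs using h
  set F : Finset (Fin r × Fin r) := Finset.univ.image fun i => (i, j i) with hF
  have hmem : ∀ i k, (i, k) ∈ F ↔ k = j i := by
    intro i k
    simp [hF, Prod.ext_iff, eq_comm]
  have hlab : ∀ i, (initialLabel w F).robot i = w i (j i) := by
    intro i
    have hex : ∃ k, (i, k) ∈ F := ⟨j i, (hmem i _).2 rfl⟩
    simp only [initialLabel]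
    rw [dif_pos hex, (hmem i _).1 hex.choose_spec]
  have htar : ∀ k, (initialLabel w F).target k = 0 := fun k => rfl
  refine ⟨F, ?_, fun i k => ?_, fun e he => ?_, fun i => Or.inl ?_⟩
  · rw [hF, Finset.card_image_of_injective _ fun i i' hi => congrArg Prod.fst hi, Finset.card_univ,
      Fintype.card_fin]
  · rw [hlab, htar, add_zero]
    exact hj i k
  · rw [hlab, htar, add_zero, ← (hmem e.1 e.2).1 he]
  · rw [hs i]
    refine ⟨rfl, ?_, ?_⟩
    · simp [hmem]
    · rintro ⟨a, b⟩ he rfl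
      simp [(hmem a b).1 he]

variable {A : Routines w} {G : ℕ → Digraph (Fin r)} {active : ℕ → Fin r → Prop}
  {s : ℕ → Fin r → RobotState r} {F : Finset (Fin r × Fin r)}

lemma IsExecution.isConsistent (hs : IsExecution A G active s) (hFr : F.card = r)
    (h0 : ∀ i, IsConsistent A F i (s 0 i)) (t : ℕ) : ∀ i, IsConsistent A F i (s t i) := by
  induction t with
  | zero => exact h0
  | succ t ih =>
    intro i
    by_cases ha : active t i
    · exact ((hs.step t i ha).spec hFr (by simp) ih).1
    · rw [hs.stay t i ha]
      exact ih i

lemma IsExecution.counter_mono (hs : IsExecution A G active s) (hFr : F.card = r)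
    (hc : ∀ t i, IsConsistent A F i (s t i)) (i : Fin r) : Monotone fun t => (s t i).counter := by
  refine monotone_nat_of_le_succ fun t => ?_
  by_cases ha : active t i
  · exact ((hs.step t i ha).spec hFr (by simp) (hc t)).2.1 i (by simp)
  · rw [hs.stay t i ha]

/-- A counter beyond `n` would have passed a final stage, which `IsConsistent` excludes. -/
lemma counter_le_of_isFinal (hc : ∀ t i, IsConsistent A F i (s t i)) {n : ℕ} (hn : IsFinal A F n)
    (t : ℕ) (i : Fin r) : (s t i).counter ≤ n := by
  by_contra! h
  obtain ⟨m, hm⟩ := Int.eq_ofNat_of_zero_le (by omega : 0 ≤ (s t i).counter)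
  exact ((hc t i).of_counter hm).2.2.2.1 n (by omega) hn

lemma IsExecution.foundPerfect_mono (hs : IsExecution A G active s) (hFr : F.card = r)
    (hc : ∀ t i, IsConsistent A F i (s t i)) {t t' : ℕ} (htt : t ≤ t') {i : Fin r}
    (h : FoundPerfect A (s t i)) : FoundPerfect A (s t' i) := by
  obtain ⟨n, hn, hf⟩ := (hc t i).foundPerfect_iff.1 h
  have h1 : (s t i).counter ≤ (s t' i).counter := hs.counter_mono hFr hc i htt
  have h2 := counter_le_of_isFinal hc hf t' i
  exact (hc t' i).foundPerfect_iff.2 ⟨n, by omega, hf⟩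

lemma IsExecution.active_of_not_foundPerfect (hs : IsExecution A G active s) (hFr : F.card = r)
    (hc : ∀ t i, IsConsistent A F i (s t i)) {t : ℕ} (h : ∀ i, ¬ FoundPerfect A (s t i))
    (i : Fin r) : active t i := by
  by_contra ha
  obtain ⟨k, hk, hp⟩ := hs.halt t i ha
  exact h i (hs.foundPerfect_mono hFr hc (by omega) hp)

/-- Before a perfect matching is found, the maximal counter value increases within `2 * r - 1`
rounds. -/
lemma IsExecution.exists_counter_lt (hs : IsExecution A G active s) (hFr : F.card = r)
    (hG : ∀ t, StronglyConnected (G t)) (hr : 0 < r)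
    (hc : ∀ t i, IsConsistent A F i (s t i)) {t : ℕ} (ht : ∀ i, ¬ FoundPerfect A (s t i)) :
    ∃ t', t < t' ∧ t' < t + 2 * r ∧ ∃ i, ∀ j, (s t j).counter < (s t' i).counter := by
  by_contra! hcon
  have : Nonempty (Fin r) := ⟨⟨0, hr⟩⟩
  obtain ⟨i0, hi0⟩ := Finite.exists_max fun j => (s t j).counter
  -- If the claim fails, the maximal counter stays frozen throughout the window.
  have hle : ∀ t', t ≤ t' → t' < t + 2 * r → ∀ i, (s t' i).counter ≤ (s t i0).counter := by
    intro t' h1 h2 i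
    rcases h1.eq_or_lt with rfl | h1
    · exact hi0 i
    · obtain ⟨j, hj⟩ := hcon t' h1 h2 i
      exact hj.trans (hi0 j)
  -- A perfect matching found in the window would belong to the frozen maximum, hence to `i0`
  -- already at time `t`. So nobody stops.
  have hact : ∀ t', t ≤ t' → t' < t + 2 * r → ∀ i, active t' i := by
    intro t' h1 h2 i
    refine hs.active_of_not_foundPerfect hFr hc (fun i hi => ht i0 ?_) i
    obtain ⟨n, hn, hf⟩ := (hc t' i).foundPerfect_iff.1 hi
    have h3 := hle t' h1 h2 i
    have h4 := counter_le_of_isFinal hc hf t i0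
    exact (hc t i0).foundPerfect_iff.2 ⟨n, by omega, hf⟩
  have hstep : ∀ t', t ≤ t' → t' < t + 2 * r → ∀ i j, (i = j ∨ (G t').Adj i j) →
      i ∈ Finset.univ.filter fun k => k = j ∨ (active t' k ∧ (G t').Adj k j) := by
    intro t' h1 h2 i j hij
    simpa [hact t' h1 h2 i] using hij
  have hself : ∀ t' i, i ∈ Finset.univ.filter fun k => k = i ∨ (active t' k ∧ (G t').Adj k i) := by
    simp
  have hmono : ∀ t', t ≤ t' → t' < t + 2 * r → ∀ i j, (i = j ∨ (G t').Adj i j) →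
      (s t' i).counter ≤ (s (t' + 1) j).counter := by
    intro t' h1 h2 i j hij
    exact ((hs.step t' j (hact t' h1 h2 j)).spec hFr (hself t' j) (hc t')).2.1 i
      (hstep t' h1 h2 i j hij)
  rcases (hc t i0).neg_one_le.eq_or_lt with hm | hm
  -- Maximum `-1`: after `r - 1` rounds everybody knows `F`, and the next round would raise the
  -- counters to at least `0`.
  · have hall : ∀ t', t ≤ t' → t' < t + 2 * r → ∀ i, (s t' i).counter = -1 ∧
        (s t' i).eqEdges ⊆ F ∧ ∀ e ∈ F, e.1 = i → e ∈ (s t' i).eqEdges := by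
      intro t' h1 h2 i
      have h3 := hle t' h1 h2 i
      rcases hc t' i with h | ⟨n, hn, -⟩
      · exact h
      · omega
    have hgrow : ∀ t', t ≤ t' → t' + 1 < t + 2 * r → ∀ i j, (i = j ∨ (G t').Adj i j) →
        (s t' i).eqEdges ⊆ (s (t' + 1) j).eqEdges ∧ (s (t' + 1) j).eqEdges ≠ F := by
      intro t' h1 h2 i j hij
      have h3 := ((hs.step t' j (hact t' h1 (by omega) j)).spec hFr (hself t' j) (hc t')).2.2.1
        (hall (t' + 1) (by omega) h2 j).1
      exact ⟨h3.2 i (hstep t' h1 (by omega) i j hij), h3.1⟩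
    have hflood : ∀ e ∈ F, ∀ i, e ∈ (s (t + (r - 1)) i).eqEdges := fun e he =>
      flooding hG (fun t' i => e ∈ (s t' i).eqEdges) t
        ⟨e.1, (hall t le_rfl (by omega) e.1).2.2 e he rfl⟩
        (fun t' h1 h2 i h => (hgrow t' h1 (by omega) i i (Or.inl rfl)).1 h)
        (fun t' h1 h2 i j h hij => (hgrow t' h1 (by omega) i j (Or.inr hij)).1 h)
    obtain ⟨h3, h4⟩ := hgrow (t + (r - 1)) (by omega) (by omega) i0 i0 (Or.inl rfl)
    exact h4 ((hall _ (by omega) (by omega) i0).2.1.antisymm fun e he => h3 (hflood e he i0))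
  -- Maximum `n ≥ 0`: the counter floods, then the candidates flood, and round `2 * r - 1` would
  -- have to advance.
  · obtain ⟨n, hn⟩ := Int.eq_ofNat_of_zero_le (by omega : 0 ≤ (s t i0).counter)
    have hnf : ¬ IsFinal A F n := fun h => ht i0 ((hc t i0).foundPerfect_iff.2 ⟨n, hn, h⟩)
    have hreach : ∀ i, (s (t + (r - 1)) i).counter = n := by
      refine flooding hG (fun t' i => (s t' i).counter = n) t ⟨i0, hn⟩ ?_ ?_
      · intro t' h1 h2 i h
        have h3 := hle (t' + 1) (by omega) (by omega) i
        have h4 := hmono t' h1 (by omega) i i (Or.inl rfl)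
        omega
      · intro t' h1 h2 i j h hij
        have h3 := hle (t' + 1) (by omega) (by omega) j
        have h4 := hmono t' h1 (by omega) i j (Or.inr hij)
        omega
    have hall : ∀ t', t + (r - 1) ≤ t' → t' < t + 2 * r → ∀ i, (s t' i).counter = n := by
      intro t' h1 h2 i
      have h3 := hle t' (by omega) h2 i
      have h4 : (s (t + (r - 1)) i).counter ≤ (s t' i).counter := hs.counter_mono hFr hc i h1
      have h5 := hreach i
      omega
    have hgrow : ∀ t', t + (r - 1) ≤ t' → t' + 1 < t + 2 * r → ∀ i j,
        (i = j ∨ (G t').Adj i j) → (s t' i).candEdges ⊆ (s (t' + 1) j).candEdges ∧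
          (s t' i).candEdges ≠ allCandidates A (stage A F n).1 (stage A F n).2 := by
      intro t' h1 h2 i j hij
      exact ((hs.step t' j (hact t' (by omega) (by omega) j)).spec hFr (hself t' j)
        (hc t')).2.2.2 n (hall (t' + 1) (by omega) h2 j) hnf i
        (hstep t' (by omega) (by omega) i j hij) (hall t' h1 (by omega) i)
    have hflood : ∀ e ∈ allCandidates A (stage A F n).1 (stage A F n).2, ∀ i,
        e ∈ (s (t + (r - 1) + (r - 1)) i).candEdges := by
      intro e he
      refine flooding hG (fun t' i => e ∈ (s t' i).candEdges) (t + (r - 1)) ?_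
        (fun t' h1 h2 i h => (hgrow t' h1 (by omega) i i (Or.inl rfl)).1 h)
        (fun t' h1 h2 i j h hij => (hgrow t' h1 (by omega) i j (Or.inr hij)).1 h)
      obtain ⟨i, -, hi⟩ := Finset.mem_biUnion.1 he
      -- By consistency each robot at stage `n` already holds its own candidate; the second flooding
      -- starts there.
      exact ⟨i, ((hc _ i).of_counter (hreach i)).2.2.2.2 hnf hi⟩
    refine (hgrow (t + (r - 1) + (r - 1)) (by omega) (by omega) i0 i0 (Or.inl rfl)).2 ?_
    exact ((hc _ i0).of_counter (hall _ (by omega) (by omega) i0)).2.2.1.antisymm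
      fun e he => hflood e he i0

lemma counter_le (hF : IsFeasible w (initialLabel w F)) (htF : IsTight w (initialLabel w F) F)
    (hr : 0 < r) (hc : ∀ t i, IsConsistent A F i (s t i)) (t : ℕ) (i : Fin r) :
    (s t i).counter ≤ 3 * (r : ℤ) ^ 2 := by
  rcases hc t i with h | ⟨n, hn, -, -, -, hm, -⟩
  · rw [h.1]
    have : 0 ≤ (r : ℤ) ^ 2 := by positivity
    omega
  · rw [hn]
    exact_mod_cast le_of_not_isFinal A hF htF hr hm

/-- Some robot finds a perfect matching within `O(r ^ 3)` rounds. -/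
lemma IsExecution.exists_foundPerfect (hs : IsExecution A G active s) (hFr : F.card = r)
    (hF : IsFeasible w (initialLabel w F)) (htF : IsTight w (initialLabel w F) F)
    (hG : ∀ t, StronglyConnected (G t)) (hr : 0 < r) (hc : ∀ t i, IsConsistent A F i (s t i)) :
    ∃ t ≤ (3 * r ^ 2 + 2) * (2 * r), ∃ i, FoundPerfect A (s t i) := by
  -- Starting from `-1`, every `2 * r` rounds gain at least one; for `k = 3 * r ^ 2 + 2` the counter
  -- would exceed its bound `3 * r ^ 2`.
  have key : ∀ k : ℕ, (∃ t ≤ k * (2 * r), ∃ i, FoundPerfect A (s t i)) ∨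
      ∃ t ≤ k * (2 * r), ∃ i, (k : ℤ) - 1 ≤ (s t i).counter := by
    intro k
    induction k with
    | zero => exact Or.inr ⟨0, by simp, ⟨0, hr⟩, by simpa using (hc 0 ⟨0, hr⟩).neg_one_le⟩
    | succ k ih =>
      rw [Nat.succ_mul]
      rcases ih with ⟨t, ht, h⟩ | ⟨t, ht, i, hi⟩
      · exact Or.inl ⟨t, by omega, h⟩
      by_cases h : ∃ i, FoundPerfect A (s t i)
      · exact Or.inl ⟨t, by omega, h⟩
      · push Not at h
        obtain ⟨t', h1, h2, j, hj⟩ := hs.exists_counter_lt hFr hG hr hc h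
        have := hj i
        exact Or.inr ⟨t', by omega, j, by push_cast; omega⟩
  rcases key (3 * r ^ 2 + 2) with h | ⟨t, -, i, hi⟩
  · exact h
  · have := counter_le hF htF hr hc t i
    push_cast at hi
    omega

/-- Once a robot has found a perfect matching, it takes `r - 1` rounds until all the robots have the
same optimal assignment. -/
lemma IsExecution.exists_common_assignment (hs : IsExecution A G active s) (hFr : F.card = r)
    (hF : IsFeasible w (initialLabel w F)) (htF : IsTight w (initialLabel w F) F)
    (hG : ∀ t, StronglyConnected (G t)) (hc : ∀ t i, IsConsistent A F i (s t i)) {t₀ : ℕ}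
    (h : ∃ i, FoundPerfect A (s t₀ i)) :
    ∃ T ≤ t₀ + (r - 1), ∃ M, IsOptimalAssignment w M ∧
      ∀ t, T ≤ t → ∀ i, 0 ≤ (s t i).counter ∧ assignment A (s t i) = M := by
  have hex : ∃ t, ∃ i, FoundPerfect A (s t i) := ⟨t₀, h⟩
  -- The earliest such time is needed: only then is it certain that no robot stops during the next
  -- `r - 1` rounds.
  obtain ⟨i₁, hi₁⟩ := Nat.find_spec hex
  have hmin := fun t => Nat.find_min hex (m := t)
  have hle : Nat.find hex ≤ t₀ := Nat.find_min' hex h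
  set t₁ := Nat.find hex
  obtain ⟨N, hN, hf⟩ := (hc t₁ i₁).foundPerfect_iff.1 hi₁
  have hact : ∀ t, t < t₁ + (r - 1) → ∀ i, active t i := by
    intro t ht i
    by_contra ha
    obtain ⟨k, hk, hp⟩ := hs.halt t i ha
    exact hmin k (by omega) ⟨i, hp⟩
  have hkeep : ∀ t t', t ≤ t' → ∀ i, (s t i).counter = N → (s t' i).counter = N := by
    intro t t' htt i hi
    have h1 : (s t i).counter ≤ (s t' i).counter := hs.counter_mono hFr hc i htt
    have h2 := counter_le_of_isFinal hc hf t' i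
    omega
  have hall := flooding hG (fun t i => (s t i).counter = N) t₁ ⟨i₁, hN⟩
    (fun t _ _ i hi => hkeep t (t + 1) (by omega) i hi)
    (fun t h1 h2 i j hi hij => by
      have h3 := ((hs.step t j (hact t h2 j)).spec hFr (by simp) (hc t)).2.1 i
        (by simp [hact t h2 i, hij])
      have h4 := counter_le_of_isFinal hc hf (t + 1) j
      omega)
  have hfeas := stage_feasible A hF htF N ((hc t₁ i₁).of_counter hN).2.2.2.1
  have hM := A.matching_spec (stage A F N).1
  refine ⟨t₁ + (r - 1), by omega, A.matching (stage A F N).1,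
    hfeas.1.isOptimalAssignment ⟨hM.2.1, hf⟩ fun e he => hfeas.2 e (hM.1 he), fun t ht i => ?_⟩
  have h1 := hkeep _ t ht i (hall i)
  exact ⟨by omega, by rw [assignment, ((hc t i).of_counter h1).1]⟩

end

end DistHungarian

theorem mainTheorem2 :
    ∃ C : ℕ, ∀ (r : ℕ), 0 < r →
      ∀ (p : DistHungarian.AssignmentProblem r)
        (A : DistHungarian.Routines p.weight)
        (G : ℕ → Digraph (Fin r)),
        (∀ t, DistHungarian.StronglyConnected (G t)) →
        ∀ (active : ℕ → Fin r → Prop) (s : ℕ → Fin r → DistHungarian.RobotState r),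
          DistHungarian.IsExecution A G active s →
          -- all robots reach, and then keep, a common optimal assignment within `C * r ^ 3` rounds
          (∃ T : ℕ, T ≤ C * r ^ 3 ∧
            ∃ M : Finset (Fin r × Fin r), DistHungarian.IsOptimalAssignment p.weight M ∧
              ∀ t, T ≤ t → ∀ i,
                0 ≤ (s t i).counter ∧ DistHungarian.assignment A (s t i) = M) ∧
          -- the counters, which start at `-1`, never exceed `C * r ^ 2`
          (∀ t i, (s t i).counter ≤ (C : ℤ) * (r : ℤ) ^ 2) ∧
          -- as long as no robot has found a perfect matching, the maximal counter value
          -- increases within `2 * r - 1` rounds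
          (∀ t, (∀ i, ¬ DistHungarian.FoundPerfect A (s t i)) →
            ∃ t', t < t' ∧ t' < t + 2 * r ∧
              ∃ i, ∀ j, (s t j).counter < (s t' i).counter) := by
  -- The rounds add up to `6 * r ^ 3 + 4 * r + (r - 1) ≤ 11 * r ^ 3`; the counters need only `3`.
  refine ⟨11, fun r hr p A G hG active s hs => ?_⟩
  obtain ⟨F, hFr, hF, htF, h0⟩ := DistHungarian.exists_initial_edges A hs.initial
  have hc := hs.isConsistent hFr h0
  refine ⟨?_, fun t i => ?_, fun t ht => hs.exists_counter_lt hFr hG hr hc ht⟩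
  · obtain ⟨t₀, ht₀, h⟩ := hs.exists_foundPerfect hFr hF htF hG hr hc
    obtain ⟨T, hT, hM⟩ := hs.exists_common_assignment hFr hF htF hG hc h
    refine ⟨T, ?_, hM⟩
    have h1 : r ≤ r ^ 3 := Nat.le_self_pow (by norm_num) r
    have h2 : (3 * r ^ 2 + 2) * (2 * r) = 6 * r ^ 3 + 4 * r := by ring
    omega
  · have h1 := DistHungarian.counter_le hF htF hr hc t i
    have h2 : 0 ≤ (r : ℤ) ^ 2 := by positivity
    push_cast
    omega
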